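/- Consider a server holding $N$ files $\mathcal N=\{1,\dots,N\}$ of $F$ bits each, and $K$ users, each with a cache of at most $MF$ bits, where $M\ge 0$ is real. A caching scheme (for file size $F$) consists of placement functions, by which each user stores at most $MF$ bits that are an arbitrary function of the $N$ files; of a server message for each request vector $d\in\mathcal N^K$ (user $k$ requests file $d_k$), which is a function of the files and has a number of bits that depends only on $d$; and of decoding functions, by which each user recovers its requested file exactly from $d$, the server message and its own cache content, for all contents of the files and all $d$. The requests $\mathsf d_1,\dots,\mathsf d_K$ are independent, each equal to $n$ with probability $p_n$, where $p_n\ge0$ and $\sum_n p_n=1$. The expected rate of a scheme is the expected number of bits of the server message divided by $F$. A rate is achievable if for every large enough $F$ there is a scheme whose expected rate is at most this rate, and the optimal expected rate $R^\star(M,\mathcal N,K)$ is the infimum of all achievable rates. Define $$R(M,N,K)=K\,(1-M/N)\,\min\Bigl\{\frac{N}{KM}\bigl(1-(1-M/N)^K\bigr),\ \frac NK\Bigr\}\qquad\text{for } M\in(0,N],$$ $R(0,N,K)=\min\{N,K\}$, and $R(M,N,K)=0$ for $M>N$; for $K=0$ the value is $0$. **Theorem.** Let $\mathcal N_1,\dots,\mathcal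 N_L$ be any partition of $\mathcal N$, let $N_\ell=|\mathcal N_\ell|$, and let $\mathsf K_\ell$ be the random number of users that request a file in $\mathcal N_\ell$. Then $$R^\star(M,\mathcal N,K)\ \le\ \min_{\substack{M_1,\dots,M_L\ge 0\\ \sum_\ell M_\ell=M}}\ \sum_{\ell=1}^L \mathbb E\bigl(R(M_\ell,N_\ell,\mathsf K_\ell)\bigr)\ \le\ \sum_{\ell=1}^L \mathbb E\bigl(R(M/L,N_\ell,\mathsf K_\ell)\bigr),$$ where the minimum is attained. -/

import Mathlib

open Filter

noncomputable section

/-- A caching scheme for `N` files of `F` bits each and `K` users with `C` bits of cache each.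
In the placement phase, user `k` stores an arbitrary function of the library of files.
In the delivery phase, once the request vector `d` is revealed (user `k` requests file `d k`),
the server sends a message of `msgLen d` bits over the shared link; from this message and its own
cache content every user reconstructs its requested file, for every library and every request
vector. -/
structure CachingScheme (N K F C : ℕ) where
  place : Fin K → (Fin N → Fin F → Bool) → (Fin C → Bool)
  msgLen : (Fin K → Fin N) → ℕ
  send : (d : Fin K → Fin N) → (Fin N → Fin F → Bool) → (Fin (msgLen d) → Bool)
  recover : (d : Fin K → Fin N) → Fin K → (Fin (msgLen d) → Bool) → (Fin C → Bool) →
    (Fin F → Bool)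
  recover_eq : ∀ (d : Fin K → Fin N) (W : Fin N → Fin F → Bool) (k : Fin K),
    recover d k (send d W) (place k W) = W (d k)

/-- Expectation of `f d` when the entries of the request vector `d` are independent, each
distributed according to the popularities `p`. -/
def demandExp {N K : ℕ} (p : Fin N → ℝ) (f : (Fin K → Fin N) → ℝ) : ℝ :=
  ∑ d : Fin K → Fin N, (∏ k, p (d k)) * f d

/-- The expected load of the shared link, normalized by the file size. -/
def CachingScheme.expectedRate {N K F C : ℕ} (S : CachingScheme N K F C) (p : Fin N → ℝ) : ℝ :=
  demandExp p (fun d => (S.msgLen d : ℝ) / (F : ℝ))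

/-- The rate `R` is achievable with normalized cache size `M` if for every large enough file size
`F` there is a scheme using at most `M * F` bits of cache per user and having expected rate at
most `R`. -/
def IsAchievable {N : ℕ} (K : ℕ) (p : Fin N → ℝ) (M R : ℝ) : Prop :=
  ∀ᶠ F : ℕ in atTop, ∃ (C : ℕ) (S : CachingScheme N K F C),
    (C : ℝ) ≤ M * (F : ℝ) ∧ S.expectedRate p ≤ R

/-- The optimal expected rate: the infimum of all achievable rates. -/
def optimalExpectedRate {N : ℕ} (K : ℕ) (p : Fin N → ℝ) (M : ℝ) : ℝ :=
  sInf {R : ℝ | IsAchievable K p M R}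

/-- The peak rate of decentralized coded caching with `N` files, `K` users and normalized cache
size `M`. (For `K = 0` the value is `0`.) -/
def peakRate (M : ℝ) (N K : ℕ) : ℝ :=
  if M = 0 then min (N : ℝ) (K : ℝ)
  else if (N : ℝ) < M then 0
  else (K : ℝ) * (1 - M / N) *
    min ((N : ℝ) / (K * M) * (1 - (1 - M / N) ^ K)) ((N : ℝ) / K)

/-- The number of users whose requested file lies in the group `G`. -/
def groupUsers {N K : ℕ} (G : Finset (Fin N)) (d : Fin K → Fin N) : ℕ :=
  (Finset.univ.filter (fun k => d k ∈ G)).card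

/-- The expected rate of grouped coded caching: the sum over the groups `G ℓ` of the expectation
of the peak rate for the files and (random number of) users in the group, when the group is
allocated the share `m ℓ` of the cache. -/
def groupedRate {N L : ℕ} (K : ℕ) (p : Fin N → ℝ) (G : Fin L → Finset (Fin N))
    (m : Fin L → ℝ) : ℝ :=
  ∑ l, demandExp p (fun d : Fin K → Fin N => peakRate (m l) (G l).card (groupUsers (G l) d))

/-- The admissible splits of the cache among `L` groups. -/
def memorySplits (L : ℕ) (M : ℝ) : Set (Fin L → ℝ) :=
  {m | (∀ l, 0 ≤ m l) ∧ ∑ l, m l = M}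

end

/-! The cache is cut along the groups, and each group runs its own deterministic form of
decentralized coded caching, so bits cached and bits sent add up over the groups. In a group with
cached fraction q, a file is cut into subfiles indexed by the set T of users that cache them, of
size about q^|T| (1-q)^(K-|T|) F. All K users take part, since placement precedes the requests.

Let U be the set of users requesting from the group. Adding up, for each S meeting U, the wanted
subfiles S \ {k} with k ∈ S ∩ U costs a geometric sum of |U| terms
(`sum_subfileFraction_not_disjoint`), independent of K. Alternatively, each file of the group is
sent as a colour of about (1-q)F bits that completes every user's partial knowledge
(`exists_common_completion`). The cheaper option has limiting rate `peakRate` (`peakRate_eq_min`,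
`tendsto_deliverySize_div`), so every split is achievable up to ε. The minimum is attained because
the rate is continuous on the compact set of splits, which contains the even split. -/

noncomputable section

/-! ### The peak rate and the compact set of memory splits -/

/-- The fraction of each of `N` equally treated files that a cache of normalized size `M` holds. -/
def cachedFraction (M : ℝ) (N : ℕ) : ℝ := min 1 (M / N)

lemma cachedFraction_nonneg {M : ℝ} (hM : 0 ≤ M) (N : ℕ) : 0 ≤ cachedFraction M N :=
  le_min zero_le_one (by positivity)

lemma cachedFraction_le_one (M : ℝ) (N : ℕ) : cachedFraction M N ≤ 1 := min_le_left _ _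

lemma natCast_mul_cachedFraction_le {M : ℝ} (hM : 0 ≤ M) (N : ℕ) :
    N * cachedFraction M N ≤ M := by
  rcases Nat.eq_zero_or_pos N with rfl | hN
  · simpa using hM
  · have hN' : (0 : ℝ) < N := by exact_mod_cast hN
    calc N * cachedFraction M N ≤ N * (M / N) := by gcongr; exact min_le_right _ _
      _ = M := by field_simp

/-- Summing the geometric series removes the division by M, so the three cases merge into one
expression that is visibly continuous at M = 0 and M = N. -/
lemma peakRate_eq_min {M : ℝ} (hM : 0 ≤ M) (N K : ℕ) :
    peakRate M N K = min (∑ i ∈ Finset.range K, (1 - cachedFraction M N) ^ (i + 1))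
      (N * (1 - cachedFraction M N)) := by
  unfold peakRate
  split_ifs with h0 hlt
  · subst h0
    simp [cachedFraction, min_comm]
  -- For an empty group M / 0 = 0 makes the cached fraction 0, but the factor N still gives rate 0.
  · rcases Nat.eq_zero_or_pos N with rfl | hN
    · simp [cachedFraction]
    · have hN' : (0 : ℝ) < N := by exact_mod_cast hN
      have hq : cachedFraction M N = 1 := min_eq_left ((one_le_div hN').2 hlt.le)
      simp [hq]
  · have hM' : 0 < M := lt_of_le_of_ne hM (Ne.symm h0)
    have hN' : (0 : ℝ) < N := hM'.trans_le (not_lt.1 hlt)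
    have hle : M / N ≤ 1 := (div_le_one hN').2 (not_lt.1 hlt)
    have hq : cachedFraction M N = M / N := min_eq_right hle
    rw [hq]
    rcases Nat.eq_zero_or_pos K with rfl | hK
    · have : 0 ≤ N * (1 - M / N) := mul_nonneg hN'.le (by linarith)
      simp [this]
    · have hK' : (0 : ℝ) < K := by exact_mod_cast hK
      rw [mul_min_of_nonneg _ _ (mul_nonneg hK'.le (by linarith))]
      congr 1
      · have hg := geom_sum_mul_neg (1 - M / N) K
        simp_rw [pow_succ]
        rw [← hg, ← Finset.sum_mul]
        field_simp
        ring
      · field_simp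

lemma continuousOn_peakRate (N K : ℕ) :
    ContinuousOn (fun M => peakRate M N K) (Set.Ici 0) := by
  refine ContinuousOn.congr (f := fun M => min
    (∑ i ∈ Finset.range K, (1 - cachedFraction M N) ^ (i + 1)) (N * (1 - cachedFraction M N)))
    (Continuous.continuousOn ?_) (fun M hM => peakRate_eq_min hM N K)
  unfold cachedFraction
  fun_prop

lemma isCompact_memorySplits (L : ℕ) (M : ℝ) : IsCompact (memorySplits L M) := by
  refine Metric.isCompact_of_isClosed_isBounded ?_ ?_
  · refine IsClosed.inter (s₁ := {m : Fin L → ℝ | ∀ l, 0 ≤ m l}) ?_ ?_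
    · simp only [Set.ofPred_forall]
      exact isClosed_iInter fun l => isClosed_le continuous_const (continuous_apply l)
    · exact isClosed_eq (by fun_prop) continuous_const
  · refine (Metric.isBounded_Icc (0 : Fin L → ℝ) (fun _ => M)).subset ?_
    rintro m ⟨h0, h1⟩
    exact ⟨h0, fun l => h1 ▸ Finset.single_le_sum (fun i _ => h0 i) (Finset.mem_univ l)⟩

lemma continuousOn_groupedRate {N L : ℕ} (K : ℕ) (p : Fin N → ℝ) (G : Fin L → Finset (Fin N))
    (M : ℝ) : ContinuousOn (groupedRate K p G) (memorySplits L M) := by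
  unfold groupedRate demandExp
  refine continuousOn_finsetSum _ fun l _ => continuousOn_finsetSum _ fun d _ =>
    continuousOn_const.mul ?_
  exact (continuousOn_peakRate _ _).comp (continuous_apply l).continuousOn fun m hm => hm.1 l

lemma div_mem_memorySplits {L : ℕ} (hL : L ≠ 0) {M : ℝ} (hM : 0 ≤ M) :
    (fun _ => M / (L : ℝ)) ∈ memorySplits L M := by
  refine ⟨fun _ => by positivity, ?_⟩
  simp only [Finset.sum_const, Finset.card_univ, Fintype.card_fin, nsmul_eq_mul]
  field_simp

/-! ### Ideal subfile sizes -/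

/-- The fraction of a file that is cached exactly by a given set of `t` out of `K` users. -/
def subfileFraction (K : ℕ) (q : ℝ) (t : ℕ) : ℝ := q ^ t * (1 - q) ^ (K - t)

lemma subfileFraction_nonneg {q : ℝ} (h0 : 0 ≤ q) (h1 : q ≤ 1) (K t : ℕ) :
    0 ≤ subfileFraction K q t :=
  mul_nonneg (pow_nonneg h0 _) (pow_nonneg (by linarith) _)

/-- The binomial expansion of (q + (1 - q))^|V| = 1; each user outside V contributes a factor 1 - q
for not caching. -/
lemma sum_powerset_subfileFraction {K : ℕ} (q : ℝ) (V : Finset (Fin K)) :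
    ∑ T ∈ V.powerset, subfileFraction K q T.card = (1 - q) ^ (K - V.card) := by
  have hV : V.card ≤ K := by simpa using V.card_le_univ
  have h := Finset.sum_pow_mul_eq_add_pow q (1 - q) V
  rw [add_sub_cancel, one_pow] at h
  have h' := congrArg (· * (1 - q) ^ (K - V.card)) h
  simp only [one_mul] at h'
  rw [← h', Finset.sum_mul]
  refine Finset.sum_congr rfl fun T hT => ?_
  have hT' := Finset.card_le_card (Finset.mem_powerset.1 hT)
  rw [subfileFraction, mul_assoc, ← pow_add]
  congr 2
  omega

lemma sum_subfileFraction (K : ℕ) (q : ℝ) :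
    ∑ T : Finset (Fin K), subfileFraction K q T.card = 1 := by
  have := sum_powerset_subfileFraction q (Finset.univ : Finset (Fin K))
  simpa using this

lemma filter_notMem_eq_powerset {K : ℕ} (k : Fin K) :
    (Finset.univ.filter fun T : Finset (Fin K) => k ∉ T) = (Finset.univ.erase k).powerset := by
  ext T
  simp [Finset.subset_erase]

lemma sum_subfileFraction_notMem {K : ℕ} (q : ℝ) (k : Fin K) :
    ∑ T : Finset (Fin K) with k ∉ T, subfileFraction K q T.card = 1 - q := by
  have hK : 0 < K := k.pos
  rw [filter_notMem_eq_powerset, sum_powerset_subfileFraction,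
    Finset.card_erase_of_mem (Finset.mem_univ k), Finset.card_univ, Fintype.card_fin,
    show K - (K - 1) = 1 by omega, pow_one]

lemma sum_subfileFraction_mem {K : ℕ} (q : ℝ) (k : Fin K) :
    ∑ T : Finset (Fin K) with k ∈ T, subfileFraction K q T.card = q := by
  have h := Finset.sum_filter_add_sum_filter_not Finset.univ (fun T : Finset (Fin K) => k ∈ T)
    fun T => subfileFraction K q T.card
  rw [sum_subfileFraction, sum_subfileFraction_notMem] at h
  linarith

/-- The total size of the coded transmissions that are useful for at least one user in `U`. -/
lemma sum_subfileFraction_not_disjoint {K : ℕ} (q : ℝ) (U : Finset (Fin K)) :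
    ∑ S : Finset (Fin K) with ¬ Disjoint S U, subfileFraction K q (S.card - 1) =
      ∑ i ∈ Finset.range U.card, (1 - q) ^ (i + 1) := by
  induction U using Finset.induction_on with
  | empty => simp
  | insert u U hu ih =>
    -- The sets that become relevant with u contain u and miss U; together they weigh (1 - q)^(|U| +
    -- 1), the next term of the sum.
    have hsplit : (Finset.univ.filter fun S : Finset (Fin K) => ¬ Disjoint S (insert u U)) =
        (Finset.univ.filter fun S : Finset (Fin K) => ¬ Disjoint S U) ∪
          (insert u U)ᶜ.powerset.image (insert u) := by
      ext S
      simp only [Finset.mem_filter, Finset.mem_univ, true_and, Finset.mem_union,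
        Finset.mem_image, Finset.mem_powerset, Finset.disjoint_insert_right]
      constructor
      · intro h
        by_cases hS : Disjoint S U
        · have huS : u ∈ S := by tauto
          refine Or.inr ⟨S.erase u, fun x hx => ?_, Finset.insert_erase huS⟩
          have hx' := Finset.mem_erase.1 hx
          simpa [hx'.1] using Finset.disjoint_left.1 hS hx'.2
        · exact Or.inl hS
      · rintro (h | ⟨T, -, rfl⟩)
        · tauto
        · simp
    have hdis : Disjoint (Finset.univ.filter fun S : Finset (Fin K) => ¬ Disjoint S U)
        ((insert u U)ᶜ.powerset.image (insert u)) := by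
      rw [Finset.disjoint_left]
      intro S hS hS'
      obtain ⟨T, hT, rfl⟩ := Finset.mem_image.1 hS'
      refine (Finset.mem_filter.1 hS).2 (Finset.disjoint_insert_left.2 ⟨hu, ?_⟩)
      refine Finset.disjoint_left.2 fun x hx hxU => ?_
      have := Finset.mem_powerset.1 hT hx
      simp [hxU] at this
    have hnot : ∀ T ∈ (insert u U)ᶜ.powerset, u ∉ T := fun T hT h => by
      have := Finset.mem_powerset.1 hT h
      simp at this
    have hU : (insert u U).card ≤ K := by simpa using (insert u U).card_le_univ
    rw [hsplit, Finset.sum_union hdis, ih, Finset.card_insert_of_notMem hu,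
      Finset.sum_range_succ, Finset.sum_image]
    · congr 1
      rw [Finset.card_insert_of_notMem hu] at hU
      have h := sum_powerset_subfileFraction q (insert u U)ᶜ
      rw [Finset.card_compl, Finset.card_insert_of_notMem hu, Fintype.card_fin,
        show K - (K - (U.card + 1)) = U.card + 1 by omega] at h
      rw [← h]
      refine Finset.sum_congr rfl fun T hT => ?_
      rw [Finset.card_insert_of_notMem (hnot T hT), Nat.add_sub_cancel]
    · intro T hT T' hT' h
      rw [← Finset.erase_insert (hnot T hT), ← Finset.erase_insert (hnot T' hT'), h]

/-! ### Integer subfile sizes and their limits -/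

/-- The number of bits of a subfile that is cached by exactly `t` users, for files of `F` bits:
the subfile that nobody caches absorbs all rounding errors. -/
def subfileSize (K : ℕ) (q : ℝ) (F t : ℕ) : ℕ :=
  if t = 0 then F - ∑ T : Finset (Fin K) with T ≠ ∅, ⌊subfileFraction K q T.card * F⌋₊
  else ⌊subfileFraction K q t * F⌋₊

lemma sum_floor_subfileFraction_le {K : ℕ} {q : ℝ} (h0 : 0 ≤ q) (h1 : q ≤ 1) (F : ℕ) :
    ∑ T : Finset (Fin K) with T ≠ ∅, ⌊subfileFraction K q T.card * F⌋₊ ≤ F := by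
  have hw := subfileFraction_nonneg h0 h1 K
  have : ((∑ T : Finset (Fin K) with T ≠ ∅, ⌊subfileFraction K q T.card * F⌋₊ : ℕ) : ℝ) ≤ F := by
    push_cast
    calc ∑ T : Finset (Fin K) with T ≠ ∅, ((⌊subfileFraction K q T.card * F⌋₊ : ℕ) : ℝ)
        ≤ ∑ T : Finset (Fin K) with T ≠ ∅, subfileFraction K q T.card * F :=
          Finset.sum_le_sum fun T _ => Nat.floor_le (mul_nonneg (hw _) (Nat.cast_nonneg _))
      _ ≤ ∑ T : Finset (Fin K), subfileFraction K q T.card * F :=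
          Finset.sum_le_sum_of_subset_of_nonneg (Finset.filter_subset _ _)
            fun T _ _ => mul_nonneg (hw _) (Nat.cast_nonneg _)
      _ = F := by rw [← Finset.sum_mul, sum_subfileFraction, one_mul]
  exact_mod_cast this

lemma sum_subfileSize {K : ℕ} {q : ℝ} (h0 : 0 ≤ q) (h1 : q ≤ 1) (F : ℕ) :
    ∑ T : Finset (Fin K), subfileSize K q F T.card = F := by
  rw [← Finset.add_sum_erase _ _ (Finset.mem_univ ∅)]
  have : ∑ T ∈ Finset.univ.erase (∅ : Finset (Fin K)), subfileSize K q F T.card =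
      ∑ T : Finset (Fin K) with T ≠ ∅, ⌊subfileFraction K q T.card * F⌋₊ := by
    refine Finset.sum_congr (by ext; simp) fun T hT => ?_
    have : T ≠ ∅ := by simpa using hT
    simp [subfileSize, this]
  rw [this]
  simp only [subfileSize, Finset.card_empty, if_true]
  exact Nat.sub_add_cancel (sum_floor_subfileFraction_le h0 h1 F)

lemma tendsto_floor_mul_div {c : ℝ} (hc : 0 ≤ c) :
    Tendsto (fun F : ℕ => ((⌊c * F⌋₊ : ℕ) : ℝ) / F) atTop (nhds c) :=
  (tendsto_nat_floor_mul_div_atTop hc).comp tendsto_natCast_atTop_atTop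

lemma tendsto_subfileSize_div {K : ℕ} {q : ℝ} (h0 : 0 ≤ q) (h1 : q ≤ 1) (t : ℕ) :
    Tendsto (fun F : ℕ => (subfileSize K q F t : ℝ) / F) atTop (nhds (subfileFraction K q t)) := by
  have hw := subfileFraction_nonneg h0 h1 K
  rcases Nat.eq_zero_or_pos t with rfl | ht
  -- The limit for the uncached subfile is found as the complement of all others, since it absorbs
  -- their rounding errors.
  · have hlim : Tendsto (fun F : ℕ => 1 - ∑ T : Finset (Fin K) with T ≠ ∅,
        ((⌊subfileFraction K q T.card * F⌋₊ : ℕ) : ℝ) / F) atTop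
        (nhds (1 - ∑ T : Finset (Fin K) with T ≠ ∅, subfileFraction K q T.card)) :=
      tendsto_const_nhds.sub (tendsto_finsetSum _ fun T _ => tendsto_floor_mul_div (hw _))
    have hval : 1 - ∑ T : Finset (Fin K) with T ≠ ∅, subfileFraction K q T.card =
        subfileFraction K q 0 := by
      have h := Finset.add_sum_erase Finset.univ
        (fun T : Finset (Fin K) => subfileFraction K q T.card) (Finset.mem_univ ∅)
      rw [sum_subfileFraction, Finset.card_empty] at h
      rw [show (Finset.univ.filter fun T : Finset (Fin K) => T ≠ ∅) = Finset.univ.erase ∅ by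
        ext; simp]
      linarith
    rw [← hval]
    refine hlim.congr' ?_
    filter_upwards [eventually_gt_atTop 0] with F hF
    have hF' : (F : ℝ) ≠ 0 := by positivity
    simp only [subfileSize, if_true]
    rw [Nat.cast_sub (sum_floor_subfileFraction_le h0 h1 F), sub_div, div_self hF',
      Nat.cast_sum, Finset.sum_div]
  · simp only [subfileSize, ht.ne', if_false]
    exact tendsto_floor_mul_div (hw _)

/-- Sets containing a user are nonempty, so only sizes rounded down occur: the cache bound holds for
every F, not only in the limit. -/
lemma sum_subfileSize_mem_le {K : ℕ} {q : ℝ} (h0 : 0 ≤ q) (h1 : q ≤ 1) (F : ℕ) (k : Fin K) :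
    ((∑ T : Finset (Fin K) with k ∈ T, subfileSize K q F T.card : ℕ) : ℝ) ≤ q * F := by
  push_cast
  calc ∑ T : Finset (Fin K) with k ∈ T, (subfileSize K q F T.card : ℝ)
      ≤ ∑ T : Finset (Fin K) with k ∈ T, subfileFraction K q T.card * F := by
        refine Finset.sum_le_sum fun T hT => ?_
        have : T ≠ ∅ := Finset.ne_empty_of_mem (Finset.mem_filter.1 hT).2
        simp only [subfileSize, Finset.card_eq_zero, this, if_false]
        exact Nat.floor_le (mul_nonneg (subfileFraction_nonneg h0 h1 _ _) (Nat.cast_nonneg _))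
    _ = q * F := by rw [← Finset.sum_mul, sum_subfileFraction_mem]

/-! ### Completing partial knowledge by colouring -/

/-- Greedy colouring: a symmetric relation in which everything has fewer than `n` neighbours can be
properly coloured with `n` colours. -/
lemma exists_coloring_of_card_lt {α : Type*} [Fintype α] [DecidableEq α] (r : α → α → Prop)
    [DecidableRel r] (hsymm : ∀ x y, r x y → r y x) {n : ℕ}
    (h : ∀ x, (Finset.univ.filter (r x)).card < n) :
    ∃ c : α → Fin n, ∀ x y, x ≠ y → r x y → c x ≠ c y := by
  suffices H : ∀ s : Finset α, ∃ c : α → Fin n, ∀ x ∈ s, ∀ y ∈ s, x ≠ y → r x y → c x ≠ c y by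
    obtain ⟨c, hc⟩ := H Finset.univ
    exact ⟨c, fun x y => hc x (Finset.mem_univ x) y (Finset.mem_univ y)⟩
  intro s
  induction s using Finset.induction_on with
  | empty => exact ⟨fun x => ⟨0, (Nat.zero_le _).trans_lt (h x)⟩, by simp⟩
  | insert a s ha ih =>
    obtain ⟨c, hc⟩ := ih
    obtain ⟨v, -, hv⟩ : ∃ v ∈ (Finset.univ : Finset (Fin n)),
        v ∉ (Finset.univ.filter (r a)).image c :=
      Finset.exists_mem_notMem_of_card_lt_card
        (Finset.card_image_le.trans_lt (by simpa using h a))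
    have hv' : ∀ y, r a y → c y ≠ v := fun y hy hcy =>
      hv (Finset.mem_image.2 ⟨y, by simpa using hy, hcy⟩)
    refine ⟨Function.update c a v, fun x hx y hy hxy hr => ?_⟩
    rcases Finset.mem_insert.1 hx with rfl | hxs
    · rw [Function.update_self, Function.update_of_ne hxy.symm]
      exact (hv' y hr).symm
    · have hxa : x ≠ a := ne_of_mem_of_not_mem hxs ha
      rw [Function.update_of_ne hxa]
      rcases Finset.mem_insert.1 hy with rfl | hys
      · rw [Function.update_self]
        exact hv' x (hsymm _ _ hr)
      · rw [Function.update_of_ne (ne_of_mem_of_not_mem hys ha)]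
        exact hc x hxs y hys hxy hr

/-- A single short description of a binary word `x` completes the partial knowledge of all users
simultaneously, when user `k` knows `x` outside of a set `D k` of at most `B` positions. -/
lemma exists_common_completion {F K B : ℕ} (D : Fin K → Finset (Fin F))
    (hD : ∀ k, (D k).card ≤ B) :
    ∃ c : (Fin F → Bool) → Fin (2 ^ (B + K)), ∀ k x y,
      (∀ i, i ∉ D k → x i = y i) → c x = c y → x = y := by
  classical
  -- Words are adjacent when some user cannot tell them apart; a word has at most K * 2^B
  -- neighbours, and K < 2^K.
  obtain ⟨c, hc⟩ := exists_coloring_of_card_lt (n := 2 ^ (B + K))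
    (fun x y : Fin F → Bool => ∃ k, ∀ i, i ∉ D k → x i = y i)
    (fun x y ⟨k, hk⟩ => ⟨k, fun i hi => (hk i hi).symm⟩) (fun x => by
      calc (Finset.univ.filter fun y : Fin F → Bool => ∃ k, ∀ i, i ∉ D k → x i = y i).card
          ≤ (Finset.univ.biUnion fun k : Fin K => Finset.univ.filter fun y : Fin F → Bool =>
              ∀ i, i ∉ D k → x i = y i).card := by
            refine Finset.card_le_card fun y hy => ?_
            simpa using hy
        _ ≤ ∑ k : Fin K, (Finset.univ.filter fun y : Fin F → Bool =>
              ∀ i, i ∉ D k → x i = y i).card := Finset.card_biUnion_le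
        _ ≤ ∑ k : Fin K, 2 ^ B := by
            refine Finset.sum_le_sum fun k _ => ?_
            have hinj : (Finset.univ.filter fun y : Fin F → Bool =>
                ∀ i, i ∉ D k → x i = y i).card ≤
                (Finset.univ : Finset (D k → Bool)).card := by
              refine Finset.card_le_card_of_injOn (fun y i => y i) (fun _ _ => by simp) ?_
              intro y hy z hz hyz
              have hy' : ∀ i, i ∉ D k → x i = y i := by simpa using hy
              have hz' : ∀ i, i ∉ D k → x i = z i := by simpa using hz
              funext i
              by_cases hi : i ∈ D k
              · exact congrFun hyz ⟨i, hi⟩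
              · rw [← hy' i hi, ← hz' i hi]
            refine hinj.trans ?_
            simpa using Nat.pow_le_pow_right two_pos (hD k)
        _ < 2 ^ (B + K) := by
            have := K.lt_two_pow_self
            simp only [Finset.sum_const, Finset.card_univ, Fintype.card_fin, smul_eq_mul]
            rw [pow_add, mul_comm]
            gcongr)
  refine ⟨c, fun k x y hk hxy => ?_⟩
  by_contra hne
  exact hc x y hne ⟨k, hk⟩ hxy

/-! ### Delivery messages and schemes -/

/-- When bit `i` of file `n` is stored by the users in `cached n i`, the message `f` lets every
user in `U` recover its requested file. -/
def IsDelivery {N K F : ℕ} {X : Type*} (cached : Fin N → Fin F → Finset (Fin K))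
    (d : Fin K → Fin N) (U : Finset (Fin K)) (f : (Fin N → Fin F → Bool) → X) : Prop :=
  ∀ k ∈ U, ∀ W W' : Fin N → Fin F → Bool,
    (∀ n i, k ∈ cached n i → W n i = W' n i) → f W = f W' → W (d k) = W' (d k)

lemma IsDelivery.comp_injective {N K F : ℕ} {X Y : Type*}
    {cached : Fin N → Fin F → Finset (Fin K)} {d : Fin K → Fin N} {U : Finset (Fin K)}
    {f : (Fin N → Fin F → Bool) → X} (hf : IsDelivery cached d U f) {φ : X → Y}
    (hφ : Function.Injective φ) : IsDelivery cached d U (φ ∘ f) :=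
  fun k hk W W' hc h => hf k hk W W' hc (hφ h)

lemma IsDelivery.exists_bits {N K F : ℕ} {X : Type*} [Fintype X]
    {cached : Fin N → Fin F → Finset (Fin K)} {d : Fin K → Fin N} {U : Finset (Fin K)}
    {f : (Fin N → Fin F → Bool) → X} (hf : IsDelivery cached d U f) {m : ℕ}
    (hX : Fintype.card X ≤ 2 ^ m) :
    ∃ g : (Fin N → Fin F → Bool) → (Fin m → Bool), IsDelivery cached d U g := by
  obtain ⟨φ⟩ : Nonempty (X ↪ (Fin m → Bool)) :=
    Function.Embedding.nonempty_of_card_le (by simpa using hX)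
  exact ⟨_, hf.comp_injective φ.injective⟩

/-- Coded delivery: for every set `S` of users, the requested subfiles that are missing at exactly
one user of `S` are added up. -/
lemma exists_isDelivery_coded {N K F : ℕ} (a : ℕ → ℕ)
    (e : Fin F ≃ Σ T : Finset (Fin K), Fin (a T.card))
    (cached : Fin N → Fin F → Finset (Fin K)) (G : Finset (Fin N))
    (hcached : ∀ n ∈ G, ∀ i, cached n i = (e i).1) (d : Fin K → Fin N) (U : Finset (Fin K))
    (hU : ∀ k ∈ U, d k ∈ G) :
    ∃ f : (Fin N → Fin F → Bool) →
      (Fin (∑ S : Finset (Fin K) with ¬ Disjoint S U, a (S.card - 1)) → Bool),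
      IsDelivery cached d U f := by
  classical
  let X := Σ S : {S : Finset (Fin K) // ¬ Disjoint S U}, Fin (a (S.1.card - 1))
  -- The zero past the end of a subfile is only a default: for k ∈ S the set S \ {k} has |S| - 1
  -- elements, so the index is in range.
  let bit : (Fin N → Fin F → Bool) → Fin N → Finset (Fin K) → ℕ → ZMod 2 := fun W n T j =>
    if h : j < a T.card then (if W n (e.symm ⟨T, ⟨j, h⟩⟩) then 1 else 0) else 0
  let f : (Fin N → Fin F → Bool) → X → ZMod 2 := fun W x =>
    ∑ k ∈ x.1.1 ∩ U, bit W (d k) (x.1.1.erase k) x.2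
  have hf : IsDelivery cached d U f := by
    intro k hk W W' hc hWW'
    funext i
    by_cases hki : k ∈ cached (d k) i
    · exact hc _ _ hki
    obtain ⟨⟨T, j⟩, rfl⟩ := e.symm.surjective i
    rw [hcached _ (hU k hk), Equiv.apply_symm_apply] at hki
    replace hki : k ∉ T := hki
    -- The sum for S = T ∪ {k} reveals the missing bit: every other summand belongs to a set S \
    -- {k'} containing k, hence is cached by k.
    have hS : ¬ Disjoint (insert k T) U :=
      Finset.not_disjoint_iff.2 ⟨k, Finset.mem_insert_self k T, hk⟩
    have hj : j.1 < a ((insert k T).card - 1) := by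
      rw [Finset.card_insert_of_notMem hki, Nat.add_sub_cancel]
      exact j.2
    have hsum := congrFun hWW' ⟨⟨insert k T, hS⟩, ⟨j.1, hj⟩⟩
    have hkmem : k ∈ insert k T ∩ U := Finset.mem_inter.2 ⟨Finset.mem_insert_self k T, hk⟩
    have hrest : ∑ k' ∈ (insert k T ∩ U).erase k, bit W (d k') ((insert k T).erase k') j =
        ∑ k' ∈ (insert k T ∩ U).erase k, bit W' (d k') ((insert k T).erase k') j := by
      refine Finset.sum_congr rfl fun k' hk' => ?_
      obtain ⟨hne, hk'⟩ := Finset.mem_erase.1 hk'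
      by_cases h : j.1 < a ((insert k T).erase k').card
      · have hW := hc (d k') (e.symm ⟨(insert k T).erase k', ⟨j.1, h⟩⟩) (by
          rw [hcached _ (hU k' (Finset.mem_inter.1 hk').2), Equiv.apply_symm_apply]
          exact Finset.mem_erase.2 ⟨hne.symm, Finset.mem_insert_self k T⟩)
        simp only [bit, dif_pos h, hW]
      · simp only [bit, dif_neg h]
    simp only [f] at hsum
    rw [← Finset.add_sum_erase _ _ hkmem, ← Finset.add_sum_erase _ _ hkmem, hrest] at hsum
    have hbit := add_right_cancel hsum
    rw [Finset.erase_insert hki] at hbit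
    simp only [bit, j.2, dif_pos] at hbit
    revert hbit
    cases W (d k) (e.symm ⟨T, j⟩) <;> cases W' (d k) (e.symm ⟨T, j⟩) <;> simp
  refine hf.exists_bits (le_of_eq ?_)
  rw [Fintype.card_fun, ZMod.card, Fintype.card_sigma]
  simp only [Fintype.card_fin]
  congr 1
  exact (Finset.sum_subtype _ (by simp) fun S : Finset (Fin K) => a (S.card - 1)).symm

/-- Every file of the group is described by what completes the knowledge of any one of the
users. -/
lemma exists_isDelivery_completion {N K F B : ℕ} (cached : Fin N → Fin F → Finset (Fin K))
    (G : Finset (Fin N))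
    (hB : ∀ n ∈ G, ∀ k, (Finset.univ.filter fun i => k ∉ cached n i).card ≤ B)
    (d : Fin K → Fin N) (U : Finset (Fin K)) (hU : ∀ k ∈ U, d k ∈ G) :
    ∃ f : (Fin N → Fin F → Bool) → (Fin (G.card * (B + K)) → Bool),
      IsDelivery cached d U f := by
  classical
  have h : ∀ n : G, ∃ c : (Fin F → Bool) → Fin (2 ^ (B + K)), ∀ k x y,
      (∀ i, i ∉ (Finset.univ.filter fun i => k ∉ cached n i) → x i = y i) → c x = c y → x = y :=
    fun n => exists_common_completion _ fun k => hB n n.2 k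
  choose c hc using h
  have hf : IsDelivery cached d U fun W => (fun n : G => c n (W n)) := by
    intro k hk W W' hcache h
    refine hc ⟨d k, hU k hk⟩ k _ _ (fun i hi => hcache _ _ ?_) (congrFun h ⟨d k, hU k hk⟩)
    simpa using hi
  refine hf.exists_bits (le_of_eq ?_)
  rw [Fintype.card_fun, Fintype.card_fin, Fintype.card_coe, ← pow_mul, mul_comm]

/-- Deliveries to several sets of users can be concatenated. -/
lemma exists_isDelivery_sum {N K F L : ℕ} (cached : Fin N → Fin F → Finset (Fin K))
    (d : Fin K → Fin N) (U : Fin L → Finset (Fin K)) (hU : ∀ k, ∃ l, k ∈ U l) (m : Fin L → ℕ)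
    (h : ∀ l, ∃ f : (Fin N → Fin F → Bool) → (Fin (m l) → Bool), IsDelivery cached d (U l) f) :
    ∃ f : (Fin N → Fin F → Bool) → (Fin (∑ l, m l) → Bool),
      IsDelivery cached d Finset.univ f := by
  choose f hf using h
  have hf' : IsDelivery cached d Finset.univ fun W => (fun l => f l W) := by
    intro k _ W W' hc hW
    obtain ⟨l, hl⟩ := hU k
    exact hf l k hl W W' hc (congrFun hW l)
  refine hf'.exists_bits (le_of_eq ?_)
  simp [Fintype.card_pi, Finset.prod_pow_eq_pow_sum]

/-- Decoding needs no algorithm: any library consistent with the message and the cache has the right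
requested file, by `IsDelivery`. The true library is consistent, so the default word is never used.
-/
lemma exists_cachingScheme {N K F C : ℕ} (cached : Fin N → Fin F → Finset (Fin K))
    (hC : ∀ k, Fintype.card {x : Fin N × Fin F // k ∈ cached x.1 x.2} ≤ C)
    (m : (Fin K → Fin N) → ℕ)
    (h : ∀ d, ∃ f : (Fin N → Fin F → Bool) → (Fin (m d) → Bool),
      IsDelivery cached d Finset.univ f) :
    ∃ S : CachingScheme N K F C, S.msgLen = m := by
  classical
  choose f hf using h
  have hφ : ∀ k, Nonempty ({x : Fin N × Fin F // k ∈ cached x.1 x.2} ↪ Fin C) := fun k =>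
    Function.Embedding.nonempty_of_card_le (by simpa using hC k)
  let φ := fun k => (hφ k).some
  let place : Fin K → (Fin N → Fin F → Bool) → (Fin C → Bool) := fun k W =>
    Function.extend (φ k) (fun x => W x.1.1 x.1.2) fun _ => false
  refine ⟨{ place := place
            msgLen := m
            send := f
            recover := fun d k s c =>
              if h : ∃ W, f d W = s ∧ place k W = c then h.choose (d k) else fun _ => false
            recover_eq := fun d W k => ?_ }, rfl⟩
  have hex : ∃ W', f d W' = f d W ∧ place k W' = place k W := ⟨W, rfl, rfl⟩
  rw [dif_pos hex]
  refine hf d k (Finset.mem_univ k) _ _ (fun n i hi => ?_) hex.choose_spec.1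
  have := congrFun hex.choose_spec.2 (φ k ⟨(n, i), hi⟩)
  simpa only [place, (φ k).injective.extend_apply] using this

/-! ### Sizes and assembly of the grouped scheme -/

lemma card_filter_sigma_fst {F K : ℕ} {a : ℕ → ℕ}
    (e : Fin F ≃ Σ T : Finset (Fin K), Fin (a T.card)) (P : Finset (Fin K) → Prop)
    [DecidablePred P] :
    (Finset.univ.filter fun i => P (e i).1).card = ∑ T with P T, a T.card := by
  rw [Finset.card_filter, e.sum_comp fun x => if P x.1 then 1 else 0, Fintype.sum_sigma,
    Finset.sum_filter]
  refine Finset.sum_congr rfl fun T _ => ?_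
  split_ifs <;> simp

/-- The number of bits of a file of `F` bits that a given one of `K` users does not cache. -/
def uncachedSize (K : ℕ) (q : ℝ) (F : ℕ) : ℕ :=
  ∑ j ∈ Finset.range (K - 1 + 1), (K - 1).choose j • subfileSize K q F j

lemma sum_subfileSize_notMem {K : ℕ} (q : ℝ) (F : ℕ) (k : Fin K) :
    ∑ T : Finset (Fin K) with k ∉ T, subfileSize K q F T.card = uncachedSize K q F := by
  rw [filter_notMem_eq_powerset, Finset.sum_powerset_apply_card (subfileSize K q F),
    Finset.card_erase_of_mem (Finset.mem_univ k), Finset.card_univ, Fintype.card_fin, uncachedSize]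

lemma tendsto_uncachedSize_div {K : ℕ} {q : ℝ} (h0 : 0 ≤ q) (h1 : q ≤ 1) (hK : 0 < K) :
    Tendsto (fun F : ℕ => (uncachedSize K q F : ℝ) / F) atTop (nhds (1 - q)) := by
  have k : Fin K := ⟨0, hK⟩
  simp_rw [← sum_subfileSize_notMem q _ k, ← sum_subfileFraction_notMem q k, Nat.cast_sum,
    Finset.sum_div]
  exact tendsto_finsetSum _ fun T _ => tendsto_subfileSize_div h0 h1 _

/-- The number of bits sent, for a group of `n` files, to the set `U` of users. -/
def deliverySize {K : ℕ} (n : ℕ) (q : ℝ) (F : ℕ) (U : Finset (Fin K)) : ℕ :=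
  min (∑ S : Finset (Fin K) with ¬ Disjoint S U, subfileSize K q F (S.card - 1))
    (n * (uncachedSize K q F + K))

lemma tendsto_deliverySize_div {K : ℕ} {M : ℝ} (hM : 0 ≤ M) (n : ℕ) (U : Finset (Fin K)) :
    Tendsto (fun F : ℕ => (deliverySize n (cachedFraction M n) F U : ℝ) / F) atTop
      (nhds (peakRate M n U.card)) := by
  have h0 := cachedFraction_nonneg hM n
  have h1 := cachedFraction_le_one M n
  rw [peakRate_eq_min hM]
  set q := cachedFraction M n
  rcases Nat.eq_zero_or_pos K with rfl | hK
  · have hU : U = ∅ := Finset.eq_empty_of_isEmpty U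
    have : 0 ≤ n * (1 - q) := mul_nonneg (Nat.cast_nonneg _) (by linarith)
    simp [deliverySize, hU, this]
  · have hcoded : Tendsto (fun F : ℕ => ∑ S : Finset (Fin K) with ¬ Disjoint S U,
        (subfileSize K q F (S.card - 1) : ℝ) / F) atTop
        (nhds (∑ i ∈ Finset.range U.card, (1 - q) ^ (i + 1))) := by
      rw [← sum_subfileFraction_not_disjoint]
      exact tendsto_finsetSum _ fun S _ => tendsto_subfileSize_div h0 h1 _
    -- The K extra bits per file that pay for the colouring vanish relative to F.
    have hcompl : Tendsto (fun F : ℕ => (n : ℝ) * ((uncachedSize K q F : ℝ) / F + (K : ℝ) / F))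
        atTop (nhds (n * (1 - q + 0))) :=
      ((tendsto_uncachedSize_div h0 h1 hK).add (tendsto_const_div_atTop_nhds_zero_nat _)).const_mul _
    rw [add_zero] at hcompl
    refine (hcoded.min hcompl).congr fun F => ?_
    rw [deliverySize, Nat.cast_min, ← min_div_div_right (Nat.cast_nonneg F)]
    push_cast
    rw [Finset.sum_div, mul_div_assoc, add_div]

/-- Each file follows the placement of its unique group. A group takes at most N_ℓ q_ℓ F ≤ m_ℓ F
bits of each cache, which sums to at most M F. -/
lemma exists_cachingScheme_grouped {N K L : ℕ} {M : ℝ} (G : Fin L → Finset (Fin N))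
    (hdisj : ∀ i j, i ≠ j → Disjoint (G i) (G j)) (hcover : ∀ n, ∃ l, n ∈ G l)
    {m : Fin L → ℝ} (hm : m ∈ memorySplits L M) (F : ℕ) :
    ∃ S : CachingScheme N K F ⌊M * F⌋₊, ∀ d, S.msgLen d =
      ∑ l, deliverySize (G l).card (cachedFraction (m l) (G l).card) F
        (Finset.univ.filter fun k => d k ∈ G l) := by
  classical
  obtain ⟨hm0, hmM⟩ := hm
  choose g hg using hcover
  have hgG : ∀ n l, n ∈ G l → g n = l := fun n l hn => by
    by_contra hne
    exact Finset.disjoint_left.1 (hdisj _ _ hne) (hg n) hn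
  let q : Fin L → ℝ := fun l => cachedFraction (m l) (G l).card
  have hq0 : ∀ l, 0 ≤ q l := fun l => cachedFraction_nonneg (hm0 l) _
  have hq1 : ∀ l, q l ≤ 1 := fun l => cachedFraction_le_one _ _
  have he : ∀ l, Nonempty (Fin F ≃ Σ T : Finset (Fin K), Fin (subfileSize K (q l) F T.card)) :=
    fun l => ⟨Fintype.equivOfCardEq (by simp [sum_subfileSize (hq0 l) (hq1 l) F])⟩
  let e := fun l => (he l).some
  let cached : Fin N → Fin F → Finset (Fin K) := fun n i => (e (g n) i).1
  have hcached : ∀ l, ∀ n ∈ G l, ∀ i, cached n i = (e l i).1 := fun l n hn i => by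
    rw [← hgG n l hn]
  have hcache : ∀ k, Fintype.card {x : Fin N × Fin F // k ∈ cached x.1 x.2} ≤ ⌊M * F⌋₊ := by
    intro k
    refine Nat.le_floor ?_
    have hcard : Fintype.card {x : Fin N × Fin F // k ∈ cached x.1 x.2} =
        ∑ n, ∑ T : Finset (Fin K) with k ∈ T, subfileSize K (q (g n)) F T.card := by
      rw [Fintype.card_subtype, Finset.card_filter, Fintype.sum_prod_type]
      refine Finset.sum_congr rfl fun n _ => ?_
      rw [← card_filter_sigma_fst (e (g n)) fun T => k ∈ T, Finset.card_filter]
    have hfiber : ∀ l, (Finset.univ.filter fun n => g n = l) = G l := fun l => by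
      ext n
      simpa using ⟨fun h => h ▸ hg n, hgG n l⟩
    rw [hcard, Nat.cast_sum]
    calc ∑ n, ((∑ T : Finset (Fin K) with k ∈ T, subfileSize K (q (g n)) F T.card : ℕ) : ℝ)
        ≤ ∑ n, q (g n) * F :=
          Finset.sum_le_sum fun n _ => sum_subfileSize_mem_le (hq0 _) (hq1 _) F k
      _ = ∑ l, ((G l).card * q l) * F := by
          rw [← Finset.sum_fiberwise Finset.univ g]
          refine Finset.sum_congr rfl fun l _ => ?_
          rw [hfiber, Finset.sum_congr rfl fun n hn => by rw [hgG n l hn], Finset.sum_const,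
            nsmul_eq_mul, mul_assoc]
      _ ≤ ∑ l, m l * F := by
          gcongr with l
          exact natCast_mul_cachedFraction_le (hm0 l) _
      _ = M * F := by rw [← Finset.sum_mul, hmM]
  have hdelivery : ∀ d : Fin K → Fin N, ∃ f : (Fin N → Fin F → Bool) →
      (Fin (∑ l, deliverySize (G l).card (q l) F (Finset.univ.filter fun k => d k ∈ G l)) → Bool),
      IsDelivery cached d Finset.univ f := by
    intro d
    refine exists_isDelivery_sum cached d (fun l => Finset.univ.filter fun k => d k ∈ G l)
      (fun k => ⟨g (d k), by simpa using hg (d k)⟩) _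
      fun l => ?_
    have hU : ∀ k ∈ Finset.univ.filter fun k => d k ∈ G l, d k ∈ G l := fun k hk => by
      simpa using hk
    rcases min_choice (∑ S : Finset (Fin K) with
      ¬ Disjoint S (Finset.univ.filter fun k => d k ∈ G l), subfileSize K (q l) F (S.card - 1))
      ((G l).card * (uncachedSize K (q l) F + K)) with h | h
    · rw [deliverySize, h]
      exact exists_isDelivery_coded _ (e l) cached (G l) (hcached l) d _ hU
    · rw [deliverySize, h]
      refine exists_isDelivery_completion cached (G l) (fun n hn k => ?_) d _ hU
      simp_rw [hcached l n hn]
      rw [card_filter_sigma_fst (e l) fun T => k ∉ T, sum_subfileSize_notMem]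
  obtain ⟨S, hS⟩ := exists_cachingScheme cached hcache _ hdelivery
  exact ⟨S, fun d => congrFun hS d⟩

/-! ### Achievability and the optimum -/

lemma isAchievable_groupedRate_add {N K L : ℕ} (p : Fin N → ℝ) {M : ℝ} (hM : 0 ≤ M)
    (G : Fin L → Finset (Fin N)) (hdisj : ∀ i j, i ≠ j → Disjoint (G i) (G j))
    (hcover : ∀ n, ∃ l, n ∈ G l) {m : Fin L → ℝ} (hm : m ∈ memorySplits L M) {ε : ℝ}
    (hε : 0 < ε) : IsAchievable K p M (groupedRate K p G m + ε) := by
  have hlim : Tendsto (fun F : ℕ => ∑ l, demandExp p fun d : Fin K → Fin N =>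
      (deliverySize (G l).card (cachedFraction (m l) (G l).card) F
        (Finset.univ.filter fun k => d k ∈ G l) : ℝ) / F) atTop (nhds (groupedRate K p G m)) :=
    tendsto_finsetSum _ fun l _ => tendsto_finsetSum _ fun d _ =>
      (tendsto_deliverySize_div (hm.1 l) _ _).const_mul _
  filter_upwards [hlim.eventually (gt_mem_nhds (lt_add_of_pos_right _ hε))] with F hF
  obtain ⟨S, hS⟩ := exists_cachingScheme_grouped (K := K) G hdisj hcover hm F
  refine ⟨_, S, Nat.floor_le (by positivity), le_of_eq_of_le ?_ hF.le⟩
  simp only [CachingScheme.expectedRate, demandExp, hS]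
  rw [Finset.sum_comm]
  refine Finset.sum_congr rfl fun d _ => ?_
  rw [Nat.cast_sum, Finset.sum_div, Finset.mul_sum]

/-- Bounds the set of achievable rates below, so that its infimum lies below each of them. -/
lemma IsAchievable.nonneg {N K : ℕ} {p : Fin N → ℝ} (hp0 : ∀ n, 0 ≤ p n) {M R : ℝ}
    (h : IsAchievable K p M R) : 0 ≤ R := by
  obtain ⟨F, C, S, -, hS⟩ := h.exists
  exact le_trans (Finset.sum_nonneg fun d _ =>
    mul_nonneg (Finset.prod_nonneg fun k _ => hp0 _) (by positivity)) hS

theorem theorem1 (N K L : ℕ) (p : Fin N → ℝ) (hp0 : ∀ n, 0 ≤ p n) (hp1 : ∑ n, p n = 1)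
    (M : ℝ) (hM : 0 ≤ M) (G : Fin L → Finset (Fin N))
    (hdisj : ∀ i j, i ≠ j → Disjoint (G i) (G j)) (hcover : ∀ n, ∃ l, n ∈ G l) :
    ∃ r : ℝ, IsLeast (groupedRate K p G '' memorySplits L M) r ∧
      optimalExpectedRate K p M ≤ r ∧
      r ≤ groupedRate K p G (fun _ => M / (L : ℝ)) := by
  -- Without groups there are no files, and the popularities could not sum to 1.
  have hL : L ≠ 0 := by
    rintro rfl
    have : IsEmpty (Fin N) := ⟨fun n => (hcover n).choose.elim0⟩
    simp at hp1
  have hmem := div_mem_memorySplits hL hM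
  obtain ⟨m, hm, hmin⟩ := (isCompact_memorySplits L M).exists_isMinOn ⟨_, hmem⟩
    (continuousOn_groupedRate K p G M)
  refine ⟨groupedRate K p G m, ⟨⟨m, hm, rfl⟩, ?_⟩, ?_, hmin hmem⟩
  · rintro _ ⟨m', hm', rfl⟩
    exact hmin hm'
  · exact le_of_forall_pos_le_add fun ε hε => csInf_le ⟨0, fun R hR => hR.nonneg hp0⟩
      (isAchievable_groupedRate_add p hM G hdisj hcover hm hε)

end
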